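/- For $n\ge 1$, an invertible real $n\times n$ matrix $A$ and a full-rank lattice $\Gamma\subset\mathbb{R}^n$, an $(A,\Gamma)$ wavelet set is a Lebesgue measurable set $W\subset\mathbb{R}^n$ such that $\sum_{j\in\mathbb{Z}}\mathbf 1_W(A^jx)=1$ for a.e. $x\in\mathbb{R}^n$ and $\sum_{\gamma\in\Gamma}\mathbf 1_W(x+\gamma)=1$ for a.e. $x\in\mathbb{R}^n$. For a linear subspace $V\subset\mathbb{R}^n$ of dimension $d$, let $m_d$ denote $d$-dimensional Lebesgue measure on $V$ (the unit point mass if $d=0$), and let $\mathbf B(0,R)$ be the open Euclidean ball of radius $R$ about $0$. Let $A=\operatorname{diag}(10,\tfrac12,\tfrac12)$, so that $|\det A|>1$. There exists a full-rank lattice $\Gamma\subset\mathbb{R}^3$ such that: (1) there is no $(A,\Gamma)$ wavelet set; (2) for every $R>0$ and every subset $F\subset\Gamma$ that contains a nonzero vector, with $V=\operatorname{span}F$ and $d=\dim V$, \[ \lim_{j\to\infty} m_d\bigl(V\cap A^{-j}(\mathbf B(0,R))\bigr)=0 . \] (3) Consequently, there are no $R>0$ and no subset $F\subset\Gamma$ (whether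 or not it contains a nonzero vector) such that, with $V=\operatorname{span}F$ and $d=\dim V$, $\lim_{j\to\infty} m_d\bigl(V\cap A^{-j}(\mathbf B(0,R))\bigr)=\infty$. Thus the existence of such $R$ and $F$, which is a sufficient condition for the non-existence of $(A,\Gamma)$ wavelet sets when $|\det A|>1$, is not necessary for it. -/

import Mathlib

open MeasureTheory Filter Topology
open scoped ENNReal

/-- Action of a real `n × n` matrix on Euclidean space `ℝⁿ`. -/
noncomputable def matAct {n : ℕ} (A : Matrix (Fin n) (Fin n) ℝ) (x : EuclideanSpace ℝ (Fin n)) :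
    EuclideanSpace ℝ (Fin n) :=
  Matrix.toEuclideanLin A x

/-- `∑_{j ∈ ℤ} 1_U (A^j x)`. (Integer powers are the genuine ones when `A` is invertible.) -/
noncomputable def dilationCount {n : ℕ} (A : Matrix (Fin n) (Fin n) ℝ)
    (U : Set (EuclideanSpace ℝ (Fin n))) (x : EuclideanSpace ℝ (Fin n)) : ℝ≥0∞ :=
  ∑' j : ℤ, U.indicator (fun _ => 1) (matAct (A ^ j) x)

/-- `∑_{γ ∈ Γ} 1_U (x + γ)`. -/
noncomputable def translationCount {n : ℕ} (Γ : Submodule ℤ (EuclideanSpace ℝ (Fin n)))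
    (U : Set (EuclideanSpace ℝ (Fin n))) (x : EuclideanSpace ℝ (Fin n)) : ℝ≥0∞ :=
  ∑' γ : Γ, U.indicator (fun _ => 1) (x + (γ : EuclideanSpace ℝ (Fin n)))

/-- `U` packs and covers by `A` dilations. -/
def TilesByDilations {n : ℕ} (A : Matrix (Fin n) (Fin n) ℝ)
    (U : Set (EuclideanSpace ℝ (Fin n))) : Prop :=
  (∀ᵐ x, dilationCount A U x ≤ 1) ∧ (∀ᵐ x, 1 ≤ dilationCount A U x)

/-- `U` packs and covers by `Γ` translations. -/
def TilesByTranslations {n : ℕ} (Γ : Submodule ℤ (EuclideanSpace ℝ (Fin n)))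
    (U : Set (EuclideanSpace ℝ (Fin n))) : Prop :=
  (∀ᵐ x, translationCount Γ U x ≤ 1) ∧ (∀ᵐ x, 1 ≤ translationCount Γ U x)

/-- `W` is an `(A, Γ)` wavelet set: a Lebesgue measurable set (`NullMeasurableSet` for `volume`)
that tiles `ℝⁿ` both by `A` dilations and by `Γ` translations. -/
structure IsWaveletSet {n : ℕ} (A : Matrix (Fin n) (Fin n) ℝ)
    (Γ : Submodule ℤ (EuclideanSpace ℝ (Fin n))) (W : Set (EuclideanSpace ℝ (Fin n))) : Prop where
  measurable : NullMeasurableSet W volume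
  dilations : TilesByDilations A W
  translations : TilesByTranslations Γ W

/-- `m_d (V ∩ S)`, `d = dim V`: the `d`-dimensional Lebesgue measure of the section of `S` by the
linear subspace `V`, where Lebesgue measure on `V` is the translation invariant measure giving
mass one to the cube spanned by an orthonormal basis of `V`. For `V = {0}` it is the Dirac mass. -/
noncomputable def sectionMeasure {n : ℕ} (V : Submodule ℝ (EuclideanSpace ℝ (Fin n)))
    (S : Set (EuclideanSpace ℝ (Fin n))) : ℝ≥0∞ :=
  (stdOrthonormalBasis ℝ V).toBasis.addHaar {v : V | (v : EuclideanSpace ℝ (Fin n)) ∈ S}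

/-- The set `A^{-j} B(0, R)`. -/
noncomputable def invDilatedBall {n : ℕ} (A : Matrix (Fin n) (Fin n) ℝ) (j : ℕ) (R : ℝ) :
    Set (EuclideanSpace ℝ (Fin n)) :=
  matAct (A ^ (-(j : ℤ))) '' Metric.ball 0 R

/-- The dilation `diag(10, 1/2, 1/2)`. -/
noncomputable def exampleDilation : Matrix (Fin 3) (Fin 3) ℝ :=
  Matrix.diagonal ![10, 1 / 2, 1 / 2]

/-! The lattice consists of the vectors (p + αq + βr, q, r) with p, q, r integers, where α and β are
lacunary sums of 2^(-9^m) over even and odd m. Non-existence (`not_exists_isWaveletSet`): a wavelet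
set W has finite volume, so inside a ball B of radius R the sets A^(-j) W with j ≥ 0 have total
volume bounded independently of R. The sets A^k W pack by A^k Γ. If A^k Γ contains a nonzero vector
of length at most C ρ^k with ρ < 1, then A^k W fills only a fraction O(ρ^k / R) of B. Summing over k
shows that the dilates of W cannot cover B once R is large. Such vectors exist
(`exists_int_small_linear_form`) because α and β have extremely good dyadic approximations at
alternating scales, and these scales together leave no gap. Sections
(`tendsto_sectionMeasure_exampleDilation`): 1, α, β are rationally independent, so every nonzero
lattice vector has nonzero first coordinate. Hence V is transversal to the contracted plane x₀ = 0,
and its sections shrink at least like (2^2 / 10)^j = (2/5)^j. -/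

/-! ### Packing inequalities -/

/-- If the translates `E - t 0, …, E - t (N - 1)` are packed into `T`, then `N μ(E) ≤ μ(T)`. -/
theorem card_mul_measure_le_of_packing {G : Type*} [AddGroup G] [MeasurableSpace G]
    [MeasurableAdd₂ G] (μ : Measure G) [μ.IsAddRightInvariant] [SFinite μ] {E T : Set G}
    (hE : NullMeasurableSet E μ) (t : ℕ → G) (N : ℕ)
    (h : ∀ᵐ x ∂μ, ∑ n ∈ Finset.range N, E.indicator (fun _ => (1 : ℝ≥0∞)) (x + t n)
      ≤ T.indicator (fun _ => 1) x) :
    N * μ E ≤ μ T := by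
  have hmeas : ∀ n, AEMeasurable (fun x => E.indicator (fun _ => (1 : ℝ≥0∞)) (x + t n)) μ := by
    intro n
    have h1 : AEMeasurable (E.indicator (fun _ => (1 : ℝ≥0∞))) μ :=
      aemeasurable_const.indicator₀ hE
    exact h1.comp_quasiMeasurePreserving
      (measurePreserving_add_right μ (t n)).quasiMeasurePreserving
  calc N * μ E = ∑ n ∈ Finset.range N, ∫⁻ x, E.indicator (fun _ => (1 : ℝ≥0∞)) (x + t n) ∂μ := by
        simp_rw [lintegral_add_right_eq_self (μ := μ) (E.indicator fun _ => (1 : ℝ≥0∞))]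
        have : ∫⁻ x, E.indicator (fun _ => (1 : ℝ≥0∞)) x ∂μ = μ E := lintegral_indicator_one₀ hE
        simp [this]
    _ = ∫⁻ x, ∑ n ∈ Finset.range N, E.indicator (fun _ => (1 : ℝ≥0∞)) (x + t n) ∂μ :=
        (lintegral_finsetSum' _ fun n _ => hmeas n).symm
    _ ≤ ∫⁻ x, T.indicator (fun _ => 1) x ∂μ := lintegral_mono_ae h
    _ ≤ μ T := lintegral_indicator_one_le T

theorem sum_indicator_one_le_one_of_subsingleton {X : Type*} {E : Set X} (s : Finset ℕ)
    (f : ℕ → X) (h : ∀ m ∈ s, ∀ n ∈ s, f m ∈ E → f n ∈ E → m = n) :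
    ∑ n ∈ s, E.indicator (fun _ => (1 : ℝ≥0∞)) (f n) ≤ 1 := by
  classical
  by_cases hx : ∃ m ∈ s, f m ∈ E
  · obtain ⟨m, hm, hmE⟩ := hx
    rw [Finset.sum_eq_single m]
    · simp [hmE]
    · intro n hn hnm
      exact Set.indicator_of_notMem (fun hnE => hnm (h n hn m hm hnE hmE)) _
    · exact fun hm' => absurd hm hm'
  · push Not at hx
    rw [Finset.sum_eq_zero fun n hn => Set.indicator_of_notMem (hx n hn) _]
    exact zero_le_one

/-! ### Matrix powers and volume -/

section Dilations

variable {n : ℕ} {A : Matrix (Fin n) (Fin n) ℝ}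

theorem det_toEuclideanLin (A : Matrix (Fin n) (Fin n) ℝ) :
    LinearMap.det (Matrix.toEuclideanLin A) = A.det := by
  change LinearMap.det (Matrix.toLpLin 2 2 A) = A.det
  rw [Matrix.toLpLin_eq_toLin, LinearMap.det_toLin]

theorem matAct_mul (A B : Matrix (Fin n) (Fin n) ℝ) (x : EuclideanSpace ℝ (Fin n)) :
    matAct (A * B) x = matAct A (matAct B x) := by
  ext i
  simp [matAct, Matrix.mulVec_mulVec]

theorem matAct_zpow_neg_zpow (hA : A.det ≠ 0) (j : ℤ) (x : EuclideanSpace ℝ (Fin n)) :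
    matAct (A ^ (-j)) (matAct (A ^ j) x) = x := by
  rw [← matAct_mul, ← Matrix.zpow_add (isUnit_iff_ne_zero.mpr hA)]
  ext i
  simp [matAct]

theorem det_zpow_ne_zero (hA : A.det ≠ 0) (j : ℤ) : (A ^ j).det ≠ 0 :=
  (hA.isUnit.det_zpow j).ne_zero

theorem quasiMeasurePreserving_matAct (hA : A.det ≠ 0) :
    Measure.QuasiMeasurePreserving (matAct A) volume volume :=
  Measure.LinearMap.quasiMeasurePreserving volume (Matrix.toEuclideanLin A)
    (by rwa [det_toEuclideanLin])

theorem volume_preimage_matAct_pow (hA : A.det ≠ 0) (j : ℕ) (S : Set (EuclideanSpace ℝ (Fin n))) :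
    volume (matAct (A ^ (j : ℤ)) ⁻¹' S) = ENNReal.ofReal (|A.det|⁻¹ ^ j) * volume S := by
  have h := Measure.addHaar_preimage_linearMap volume (f := Matrix.toEuclideanLin (A ^ (j : ℤ)))
    (by rw [det_toEuclideanLin]; exact det_zpow_ne_zero hA _) S
  rw [det_toEuclideanLin] at h
  simp only [zpow_natCast, Matrix.det_pow, abs_inv, abs_pow, ← inv_pow] at h
  rw [zpow_natCast]
  exact h

end Dilations

/-! ### Packing by lattice translations -/

section Translations

variable {n : ℕ} {Γ : Submodule ℤ (EuclideanSpace ℝ (Fin n))}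

/-- A set that packs by translations along a lattice has finite measure. -/
theorem volume_lt_top_of_translationCount_le_one [DiscreteTopology Γ] [IsZLattice ℝ Γ]
    {W : Set (EuclideanSpace ℝ (Fin n))} (hW : NullMeasurableSet W volume)
    (h : ∀ᵐ x, translationCount Γ W x ≤ 1) : volume W < ∞ := by
  let b := Module.Free.chooseBasis ℤ Γ
  have hD := ZLattice.isAddFundamentalDomain b (volume : Measure (EuclideanSpace ℝ (Fin n)))
  set D := ZSpan.fundamentalDomain (b.ofZLatticeBasis ℝ) with hDdef
  have hDfin : volume D < ∞ := (ZSpan.fundamentalDomain_isBounded _).measure_lt_top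
  have hmeas : AEMeasurable (W.indicator (fun _ => (1 : ℝ≥0∞))) volume :=
    aemeasurable_const.indicator₀ hW
  have : VAddInvariantMeasure Γ (EuclideanSpace ℝ (Fin n)) volume :=
    ⟨fun γ s _ => measure_preimage_add volume (γ : EuclideanSpace ℝ (Fin n)) s⟩
  -- Fold W into the fundamental domain D: its volume is the integral over D of the translation
  -- count.
  calc volume W = ∫⁻ x, W.indicator (fun _ => (1 : ℝ≥0∞)) x := (lintegral_indicator_one₀ hW).symm
    _ = ∑' γ : Γ, ∫⁻ x in D, W.indicator (fun _ => (1 : ℝ≥0∞)) (γ +ᵥ x) := hD.lintegral_eq_tsum'' _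
    _ = ∑' γ : Γ, ∫⁻ x in D, W.indicator (fun _ => (1 : ℝ≥0∞)) (x + γ) := by
        simp [Submodule.vadd_def, add_comm]
    _ = ∫⁻ x in D, translationCount Γ W x := by
        refine (lintegral_tsum fun γ => ?_).symm
        exact (hmeas.comp_quasiMeasurePreserving
          (measurePreserving_add_right volume (γ : EuclideanSpace ℝ (Fin n))).quasiMeasurePreserving
          ).restrict
    _ ≤ ∫⁻ x in D, 1 := lintegral_mono_ae (ae_restrict_of_ae h)
    _ = volume D := by simp
    _ < ∞ := hDfin

theorem sum_indicator_add_nsmul_le_translationCount {u : EuclideanSpace ℝ (Fin n)} (hu : u ∈ Γ)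
    (hu0 : u ≠ 0) (W : Set (EuclideanSpace ℝ (Fin n))) (x : EuclideanSpace ℝ (Fin n)) (N : ℕ) :
    ∑ m ∈ Finset.range N, W.indicator (fun _ => (1 : ℝ≥0∞)) (x + (m : ℝ) • u)
      ≤ translationCount Γ W x := by
  have hinj : Function.Injective (fun m : ℕ => m • (⟨u, hu⟩ : Γ)) := by
    intro m m' hmm
    have h1 : (m : ℝ) • u = (m' : ℝ) • u := by
      have := congrArg (Subtype.val) hmm
      simpa [Nat.cast_smul_eq_nsmul] using this
    exact_mod_cast smul_left_injective ℝ hu0 h1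
  calc _ ≤ ∑' m : ℕ, W.indicator (fun _ => (1 : ℝ≥0∞)) (x + (m : ℝ) • u) := ENNReal.sum_le_tsum _
    _ = ∑' m : ℕ, (fun γ : Γ => W.indicator (fun _ => (1 : ℝ≥0∞)) (x + (γ : EuclideanSpace ℝ _)))
          (m • (⟨u, hu⟩ : Γ)) := by
        simp [Nat.cast_smul_eq_nsmul]
    _ ≤ _ := ENNReal.tsum_comp_le_tsum_of_injective hinj _

end Translations

/-! ### Short lattice vectors exclude wavelet sets -/

section WaveletSets

variable {n : ℕ} {A : Matrix (Fin n) (Fin n) ℝ} {Γ : Submodule ℤ (EuclideanSpace ℝ (Fin n))}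
  {W : Set (EuclideanSpace ℝ (Fin n))}

theorem volume_le_tsum_of_dilationCount (hA : A.det ≠ 0) (hW : NullMeasurableSet W volume)
    (h : ∀ᵐ x, 1 ≤ dilationCount A W x) (B : Set (EuclideanSpace ℝ (Fin n))) :
    volume B ≤ ∑' j : ℤ, volume (B ∩ matAct (A ^ j) ⁻¹' W) := by
  have hpre : ∀ j : ℤ, NullMeasurableSet (matAct (A ^ j) ⁻¹' W) volume := fun j =>
    hW.preimage (quasiMeasurePreserving_matAct (det_zpow_ne_zero hA j))
  calc volume B = ∫⁻ x in B, 1 := by simp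
    _ ≤ ∫⁻ x in B, dilationCount A W x := lintegral_mono_ae (ae_restrict_of_ae h)
    _ = ∑' j : ℤ, ∫⁻ x in B, (matAct (A ^ j) ⁻¹' W).indicator (fun _ => 1) x :=
        lintegral_tsum fun j => (aemeasurable_const.indicator₀ (hpre j)).restrict
    _ = ∑' j : ℤ, volume (B ∩ matAct (A ^ j) ⁻¹' W) := by
        congr 1 with j
        rw [Set.inter_comm, ← Measure.restrict_apply₀ ((hpre j).mono_ac
          Measure.restrict_le_self.absolutelyContinuous)]
        exact lintegral_indicator_one₀ ((hpre j).mono_ac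
          Measure.restrict_le_self.absolutelyContinuous)

/-- The dilate A^k W packs by A^k Γ, in particular by multiples of A^k u. Translating its part in
the ball of radius R by N multiples of length at most R stays within radius 2R. -/
theorem nat_mul_volume_ball_inter_le (hA : A.det ≠ 0) (hW : NullMeasurableSet W volume)
    (h : ∀ᵐ x, translationCount Γ W x ≤ 1) {u : EuclideanSpace ℝ (Fin n)} (hu : u ∈ Γ)
    (hu0 : u ≠ 0) {R : ℝ} (k : ℤ) (N : ℕ)
    (hN : ∀ m < N, ‖(m : ℝ) • matAct (A ^ k) u‖ ≤ R) :
    N * volume (Metric.ball 0 R ∩ matAct (A ^ (-k)) ⁻¹' W) ≤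
      volume (Metric.ball (0 : EuclideanSpace ℝ (Fin n)) (2 * R)) := by
  have hqmp := quasiMeasurePreserving_matAct (det_zpow_ne_zero hA (-k))
  refine card_mul_measure_le_of_packing volume
    (measurableSet_ball.nullMeasurableSet.inter (hW.preimage hqmp))
    (fun m => (m : ℝ) • matAct (A ^ k) u) N ?_
  filter_upwards [hqmp.ae h] with x hx
  by_cases hxT : x ∈ Metric.ball (0 : EuclideanSpace ℝ (Fin n)) (2 * R)
  · rw [Set.indicator_of_mem hxT]
    refine le_trans (Finset.sum_le_sum fun m _ => ?_)
      ((sum_indicator_add_nsmul_le_translationCount hu hu0 W _ N).trans hx)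
    have hlin : matAct (A ^ (-k)) (x + (m : ℝ) • matAct (A ^ k) u)
        = matAct (A ^ (-k)) x + (m : ℝ) • u := by
      conv_rhs => rw [← matAct_zpow_neg_zpow hA k u]
      simp [matAct]
    by_cases hy : x + (m : ℝ) • matAct (A ^ k) u ∈ Metric.ball 0 R ∩ matAct (A ^ (-k)) ⁻¹' W
    · have hyW : matAct (A ^ (-k)) x + (m : ℝ) • u ∈ W := hlin ▸ hy.2
      rw [Set.indicator_of_mem hy, Set.indicator_of_mem hyW]
    · rw [Set.indicator_of_notMem hy]
      exact zero_le
  · rw [Finset.sum_eq_zero]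
    · exact zero_le
    · intro m hm
      refine Set.indicator_of_notMem (fun hmem => hxT ?_) _
      have h1 := hmem.1
      have h2 := hN m (Finset.mem_range.mp hm)
      rw [mem_ball_zero_iff] at h1 ⊢
      calc ‖x‖ = ‖(x + (m : ℝ) • matAct (A ^ k) u) - (m : ℝ) • matAct (A ^ k) u‖ := by
            rw [add_sub_cancel_right]
        _ ≤ _ := norm_sub_le _ _
        _ < 2 * R := by linarith

/-- Nonexistence of wavelet sets for lattices that contain short vectors at every scale. -/
theorem not_exists_isWaveletSet [DiscreteTopology Γ] [IsZLattice ℝ Γ] (hA : 1 < |A.det|)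
    {C ρ : ℝ} (hC : 0 < C) (hρ : 0 < ρ) (hρ1 : ρ < 1)
    (hΓ : ∀ k : ℕ, ∃ u ∈ Γ, u ≠ 0 ∧ ‖matAct (A ^ (k : ℤ)) u‖ ≤ C * ρ ^ k) :
    ¬ ∃ W : Set (EuclideanSpace ℝ (Fin n)), IsWaveletSet A Γ W := by
  rintro ⟨W, hWm, hWd, hWt⟩
  have hdet : A.det ≠ 0 := by
    intro h0
    rw [h0, abs_zero] at hA
    linarith
  have hfin := volume_lt_top_of_translationCount_le_one hWm hWt.1
  obtain ⟨u₀, -, hu₀, -⟩ := hΓ 0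
  have : Nontrivial (EuclideanSpace ℝ (Fin n)) := ⟨u₀, 0, hu₀⟩
  have hn : n ≠ 0 := by
    rintro rfl
    exact hu₀ (Subsingleton.elim _ _)
  set v := volume (Metric.ball (0 : EuclideanSpace ℝ (Fin n)) 1) with hv
  have hv0 : 0 < v.toReal :=
    ENNReal.toReal_pos (Metric.measure_ball_pos _ _ one_pos).ne' measure_ball_lt_top.ne
  have hball : ∀ R : ℝ, 0 ≤ R → volume (Metric.ball (0 : EuclideanSpace ℝ (Fin n)) R)
      = ENNReal.ofReal (R ^ n * v.toReal) := by
    intro R hR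
    rw [Measure.addHaar_ball _ _ hR, finrank_euclideanSpace_fin,
      ENNReal.ofReal_mul (pow_nonneg hR n), ENNReal.ofReal_toReal measure_ball_lt_top.ne]
  -- the dilates by nonnegative powers
  set δ := |A.det|⁻¹ with hδ
  have hδ0 : 0 ≤ δ := by positivity
  have hδ1 : δ < 1 := inv_lt_one_of_one_lt₀ hA
  set M := (1 - δ)⁻¹ * (volume W).toReal with hM
  set K := (1 - ρ)⁻¹ * (2 ^ n * C) with hK
  have hK0 : 0 < K := by
    have : 0 < 1 - ρ := by linarith
    positivity
  have hM0 : 0 ≤ M := by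
    have : 0 < 1 - δ := by linarith
    positivity
  have key : ∀ R : ℝ, 0 < R → R ^ n * v.toReal ≤ M + K / R * (R ^ n * v.toReal) := by
    intro R hR
    have hpos : ∀ j : ℕ, volume (Metric.ball 0 R ∩ matAct (A ^ (j : ℤ)) ⁻¹' W)
        ≤ ENNReal.ofReal (δ ^ j * (volume W).toReal) := by
      intro j
      refine (measure_mono Set.inter_subset_right).trans ?_
      rw [volume_preimage_matAct_pow hdet, ENNReal.ofReal_mul (by positivity),
        ENNReal.ofReal_toReal hfin.ne]
    have hneg : ∀ k : ℕ, volume (Metric.ball 0 R ∩ matAct (A ^ (-(k : ℤ))) ⁻¹' W)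
        ≤ ENNReal.ofReal (ρ ^ k * (2 ^ n * C / R * (R ^ n * v.toReal))) := by
      intro k
      obtain ⟨u, hu, hu0, huk⟩ := hΓ k
      have hCk : 0 < C * ρ ^ k := by positivity
      set N := ⌈R / (C * ρ ^ k)⌉₊ with hNdef
      have hNle : R / (C * ρ ^ k) ≤ N := Nat.le_ceil _
      have hNpos : (0 : ℝ) < N := lt_of_lt_of_le (by positivity) hNle
      have h1 := nat_mul_volume_ball_inter_le hdet hWm hWt.1 hu hu0 (R := R) k N (by
        intro m hm
        have hm' : (m : ℝ) < R / (C * ρ ^ k) := Nat.lt_ceil.mp hm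
        rw [lt_div_iff₀ hCk] at hm'
        rw [norm_smul, Real.norm_natCast]
        exact (mul_le_mul_of_nonneg_left huk (Nat.cast_nonneg m)).trans hm'.le)
      rw [hball _ (by positivity)] at h1
      set x := volume (Metric.ball 0 R ∩ matAct (A ^ (-(k : ℤ))) ⁻¹' W) with hx
      have hxfin : x ≠ ∞ := ((measure_mono Set.inter_subset_left).trans_lt
        measure_ball_lt_top).ne
      rw [← ENNReal.ofReal_toReal hxfin, ← ENNReal.ofReal_natCast,
        ← ENNReal.ofReal_mul (Nat.cast_nonneg N),
        ENNReal.ofReal_le_ofReal_iff (by positivity)] at h1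
      rw [← ENNReal.ofReal_toReal hxfin]
      refine ENNReal.ofReal_le_ofReal ?_
      have h2 : R / (C * ρ ^ k) * x.toReal ≤ (2 * R) ^ n * v.toReal :=
        (mul_le_mul_of_nonneg_right hNle ENNReal.toReal_nonneg).trans h1
      rw [div_mul_eq_mul_div, div_le_iff₀ hCk] at h2
      have h3 : x.toReal ≤ ((2 * R) ^ n * v.toReal * (C * ρ ^ k)) / R := by
        rw [le_div_iff₀ hR]
        linarith
      refine h3.trans_eq ?_
      rw [mul_pow]
      field_simp
    have hgeo : ∀ {r c : ℝ}, 0 ≤ r → r < 1 → 0 ≤ c →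
        ∑' j : ℕ, ENNReal.ofReal (r ^ j * c) = ENNReal.ofReal ((1 - r)⁻¹ * c) := by
      intro r c hr0 hr1 hc
      rw [← ENNReal.ofReal_tsum_of_nonneg (fun j => by positivity)
        ((summable_geometric_of_lt_one hr0 hr1).mul_right c), tsum_mul_right,
        tsum_geometric_of_lt_one hr0 hr1]
    have htot : volume (Metric.ball (0 : EuclideanSpace ℝ (Fin n)) R) ≤
        ENNReal.ofReal M + ENNReal.ofReal (K / R * (R ^ n * v.toReal)) := by
      refine (volume_le_tsum_of_dilationCount hdet hWm hWd.2 _).trans ?_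
      -- The negative half is indexed by -(k + 1); its sum is then bounded by the full geometric
      -- series starting at k = 0.
      rw [tsum_of_nat_of_neg_add_one ENNReal.summable ENNReal.summable]
      refine add_le_add ?_ ?_
      · rw [hM, ← hgeo hδ0 hδ1 ENNReal.toReal_nonneg]
        exact ENNReal.tsum_le_tsum hpos
      · have : K / R * (R ^ n * v.toReal)
            = (1 - ρ)⁻¹ * (2 ^ n * C / R * (R ^ n * v.toReal)) := by
          rw [hK]; ring
        rw [this, ← hgeo hρ.le hρ1 (by positivity)]
        refine le_trans ?_ (ENNReal.tsum_comp_le_tsum_of_injective (add_left_injective 1) _)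
        refine ENNReal.tsum_le_tsum fun k => ?_
        simpa using hneg (k + 1)
    rw [hball R hR.le, ← ENNReal.ofReal_add hM0 (by positivity),
      ENNReal.ofReal_le_ofReal_iff (by positivity)] at htot
    exact htot
  -- The term 2K gives K / R ≤ 1/2, the term 1 gives R ≤ R^n, and the last term makes half the
  -- volume of the ball exceed M.
  set R := 2 * K + 1 + (2 * M + 1) / v.toReal with hR
  have hR1 : 1 ≤ R := by
    have : 0 ≤ (2 * M + 1) / v.toReal := by positivity
    linarith
  have h1 := key R (by linarith)
  have h2 : K / R ≤ 1 / 2 := by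
    rw [div_le_iff₀ (by linarith)]
    have : 0 ≤ (2 * M + 1) / v.toReal := by positivity
    linarith
  have h3 : R ≤ R ^ n := le_self_pow₀ hR1 hn
  have h4 : 2 * M + 1 ≤ R * v.toReal := by
    have : (2 * M + 1) / v.toReal ≤ R := by linarith
    rwa [div_le_iff₀ hv0] at this
  have h5 : R * v.toReal ≤ R ^ n * v.toReal := mul_le_mul_of_nonneg_right h3 hv0.le
  have h6 : K / R * (R ^ n * v.toReal) ≤ 1 / 2 * (R ^ n * v.toReal) :=
    mul_le_mul_of_nonneg_right h2 (by positivity)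
  linarith

end WaveletSets

/-! ### Lacunary sums and simultaneous approximation -/

/-- The sum `∑ c_m 2^{-9^m}` for a sequence of integers `c`. -/
noncomputable def lacunarySum (c : ℕ → ℤ) : ℝ :=
  ∑' m, (c m : ℝ) * (1 / 2) ^ 9 ^ m

theorem nine_pow_add_le (m n : ℕ) : 9 ^ n + m ≤ 9 ^ (m + n) := by
  have h1 : m + 1 ≤ 9 ^ m := Nat.lt_pow_self (by norm_num)
  have h2 : 1 ≤ 9 ^ n := Nat.one_le_pow _ _ (by norm_num)
  rw [pow_add]
  nlinarith

section Lacunary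

variable {c : ℕ → ℤ} {M : ℝ}

theorem abs_lacunary_term_le (hc : ∀ m, |(c m : ℝ)| ≤ M) (n m : ℕ) :
    ‖(c (m + n) : ℝ) * (1 / 2) ^ 9 ^ (m + n)‖ ≤ M * (1 / 2) ^ 9 ^ n * (1 / 2) ^ m := by
  have hM : 0 ≤ M := (abs_nonneg _).trans (hc 0)
  have h : ((1 : ℝ) / 2) ^ 9 ^ (m + n) ≤ (1 / 2) ^ (9 ^ n + m) :=
    pow_le_pow_of_le_one (by norm_num) (by norm_num) (nine_pow_add_le m n)
  rw [Real.norm_eq_abs, abs_mul, abs_of_pos (by positivity : (0 : ℝ) < (1 / 2) ^ 9 ^ (m + n)),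
    mul_assoc, ← pow_add]
  exact mul_le_mul (hc _) h (by positivity) hM

theorem summable_lacunary (hc : ∀ m, |(c m : ℝ)| ≤ M) :
    Summable fun m => (c m : ℝ) * (1 / 2) ^ 9 ^ m :=
  Summable.of_norm_bounded (summable_geometric_two.mul_left _) (abs_lacunary_term_le hc 0)

theorem abs_lacunarySum_sub_le (hc : ∀ m, |(c m : ℝ)| ≤ M) (n : ℕ) :
    |lacunarySum c - ∑ m ∈ Finset.range n, (c m : ℝ) * (1 / 2) ^ 9 ^ m|
      ≤ 2 * M * (1 / 2) ^ 9 ^ n := by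
  rw [lacunarySum, ← (summable_lacunary hc).sum_add_tsum_nat_add n, add_sub_cancel_left]
  refine (tsum_of_norm_bounded (summable_geometric_two.mul_left _).hasSum
    (abs_lacunary_term_le hc n)).trans_eq ?_
  rw [tsum_mul_left, tsum_geometric_two]
  ring

theorem exists_int_eq_two_pow_mul_sum (c : ℕ → ℤ) (n : ℕ) :
    ∃ s : ℤ, (2 : ℝ) ^ 9 ^ n * ∑ m ∈ Finset.range (n + 1), (c m : ℝ) * (1 / 2) ^ 9 ^ m = s := by
  refine ⟨∑ m ∈ Finset.range (n + 1), c m * 2 ^ (9 ^ n - 9 ^ m), ?_⟩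
  push_cast
  rw [Finset.mul_sum]
  refine Finset.sum_congr rfl fun m hm => ?_
  have hle : 9 ^ m ≤ 9 ^ n :=
    Nat.pow_le_pow_right (by norm_num) (Nat.lt_succ_iff.mp (Finset.mem_range.mp hm))
  rw [pow_sub₀ (2 : ℝ) (by norm_num) hle, one_div, inv_pow]
  ring

/-- If the digit after position `n` vanishes, then `2^{9^n}` is a very good denominator. -/
theorem exists_int_abs_two_pow_mul_lacunarySum_add_le (hc : ∀ m, |(c m : ℝ)| ≤ M) {n : ℕ}
    (hn : c (n + 1) = 0) :
    ∃ p : ℤ, |p + 2 ^ 9 ^ n * lacunarySum c| ≤ 2 ^ 9 ^ n * (2 * M * (1 / 2) ^ 9 ^ (n + 2)) := by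
  obtain ⟨s, hs⟩ := exists_int_eq_two_pow_mul_sum c n
  refine ⟨-s, ?_⟩
  have h := abs_lacunarySum_sub_le hc (n + 2)
  rw [Finset.sum_range_succ, hn, Int.cast_zero, zero_mul, add_zero] at h
  have h2 : ((-s : ℤ) : ℝ) + 2 ^ 9 ^ n * lacunarySum c = 2 ^ 9 ^ n *
      (lacunarySum c - ∑ m ∈ Finset.range (n + 1), (c m : ℝ) * (1 / 2) ^ 9 ^ m) := by
    push_cast
    rw [mul_sub, hs]
    ring
  rw [h2, abs_mul, abs_of_pos (by positivity)]
  exact mul_le_mul_of_nonneg_left h (by positivity)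

/-- A lacunary sum with bounded digits is an integer only if its digits vanish eventually. -/
theorem eventually_eq_zero_of_add_lacunarySum_eq_zero (hc : ∀ m, |(c m : ℝ)| ≤ M) {p : ℤ}
    (h : p + lacunarySum c = 0) : ∀ᶠ n in atTop, c n = 0 := by
  have hM : 0 ≤ M := (abs_nonneg _).trans (hc 0)
  have hlim : Tendsto (fun n : ℕ => 2 * M * (1 / 2 : ℝ) ^ n) atTop (𝓝 0) := by
    simpa using (tendsto_pow_atTop_nhds_zero_of_lt_one (by norm_num : (0 : ℝ) ≤ 1 / 2)
      (by norm_num)).const_mul (2 * M)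
  -- Multiplied by 2^(9^n), the partial sum plus p becomes an integer, and the tail bound makes it
  -- smaller than 1 in absolute value.
  have hzero : ∀ᶠ n in atTop,
      (p : ℝ) + ∑ m ∈ Finset.range (n + 1), (c m : ℝ) * (1 / 2) ^ 9 ^ m = 0 := by
    filter_upwards [hlim.eventually_lt_const one_pos] with n hn
    obtain ⟨s, hs⟩ := exists_int_eq_two_pow_mul_sum c n
    set S := ∑ m ∈ Finset.range (n + 1), (c m : ℝ) * (1 / 2) ^ 9 ^ m with hS
    have h1 : |p + S| ≤ 2 * M * (1 / 2) ^ 9 ^ (n + 1) := by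
      rw [show (p : ℝ) + S = -(lacunarySum c - S) by linarith, abs_neg]
      exact abs_lacunarySum_sub_le hc (n + 1)
    have h2 : |(2 : ℝ) ^ 9 ^ n * (p + S)| < 1 := by
      rw [abs_mul, abs_of_pos (by positivity)]
      have h3 : ((1 : ℝ) / 2) ^ 9 ^ (n + 1) ≤ (1 / 2) ^ (9 ^ n + n) := by
        refine pow_le_pow_of_le_one (by norm_num) (by norm_num) ?_
        have : n < 9 ^ n := Nat.lt_pow_self (by norm_num)
        rw [pow_succ]
        omega
      calc (2 : ℝ) ^ 9 ^ n * |p + S| ≤ 2 ^ 9 ^ n * (2 * M * (1 / 2) ^ (9 ^ n + n)) := by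
            refine mul_le_mul_of_nonneg_left (h1.trans ?_) (by positivity)
            exact mul_le_mul_of_nonneg_left h3 (by positivity)
        _ = 2 * M * (1 / 2) ^ n * (2 * (1 / 2)) ^ 9 ^ n := by rw [pow_add, mul_pow]; ring
        _ < 1 := by norm_num at hn ⊢; exact hn
    have h4 : (2 : ℝ) ^ 9 ^ n * (p + S) = ((2 ^ 9 ^ n * p + s : ℤ) : ℝ) := by
      push_cast
      rw [mul_add, hs]
    rw [h4, ← Int.cast_abs] at h2
    have h5 : (2 ^ 9 ^ n * p + s : ℤ) = 0 := Int.abs_lt_one_iff.mp (by exact_mod_cast h2)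
    rw [h5, Int.cast_zero] at h4
    exact (mul_eq_zero.mp h4).resolve_left (by positivity)
  -- Two consecutive partial sums both equal -p, so the term between them vanishes.
  obtain ⟨n₀, hn₀⟩ := eventually_atTop.mp hzero
  filter_upwards [eventually_ge_atTop (n₀ + 1)] with n hn
  have h1 := hn₀ n (by omega)
  have h2 := hn₀ (n - 1) (by omega)
  rw [Nat.sub_add_cancel (by omega)] at h2
  rw [Finset.sum_range_succ, ← add_assoc, h2, zero_add] at h1
  exact_mod_cast (mul_eq_zero.mp h1).resolve_right (by positivity)

end Lacunary

/-- The sequence `q, r, q, r, …`. -/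
def alternatingDigits (q r : ℤ) (m : ℕ) : ℤ := if Even m then q else r

theorem abs_alternatingDigits_le (q r : ℤ) (m : ℕ) :
    |(alternatingDigits q r m : ℝ)| ≤ max |(q : ℝ)| |(r : ℝ)| := by
  unfold alternatingDigits
  split_ifs
  · exact le_max_left _ _
  · exact le_max_right _ _

theorem lacunarySum_alternatingDigits (q r : ℤ) :
    lacunarySum (alternatingDigits q r)
      = q * lacunarySum (alternatingDigits 1 0) + r * lacunarySum (alternatingDigits 0 1) := by
  unfold lacunarySum
  rw [← tsum_mul_left, ← tsum_mul_left, ← Summable.tsum_add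
    ((summable_lacunary (abs_alternatingDigits_le 1 0)).mul_left _)
    ((summable_lacunary (abs_alternatingDigits_le 0 1)).mul_left _)]
  congr 1 with m
  unfold alternatingDigits
  split_ifs <;> simp

/-- Linear independence over the rationals of `1` and the two alternating lacunary sums. -/
theorem eq_zero_of_add_lacunarySum_alternatingDigits_eq_zero {p q r : ℤ}
    (h : p + lacunarySum (alternatingDigits q r) = 0) : p = 0 ∧ q = 0 ∧ r = 0 := by
  obtain ⟨n, hn⟩ := eventually_atTop.mp
    (eventually_eq_zero_of_add_lacunarySum_eq_zero (abs_alternatingDigits_le q r) h)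
  have hq : q = 0 := by simpa [alternatingDigits] using hn (2 * n) (by omega)
  have hr : r = 0 := by simpa [alternatingDigits] using hn (2 * n + 1) (by omega)
  subst hq hr
  refine ⟨?_, rfl, rfl⟩
  simpa [lacunarySum, alternatingDigits] using h

/-- At every scale there is a nonzero integer vector at which the linear form with coefficients
`1` and the alternating lacunary sums is very small. -/
theorem exists_int_small_linear_form (k : ℕ) :
    ∃ p q r : ℤ, (q ≠ 0 ∨ r ≠ 0) ∧
      10 ^ k * |p + lacunarySum (alternatingDigits q r)| ≤ 2 * (3 / 4) ^ k ∧
      (1 / 2) ^ k * |(q : ℝ)| ≤ 2 * (3 / 4) ^ k ∧ (1 / 2) ^ k * |(r : ℝ)| ≤ 2 * (3 / 4) ^ k := by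
  -- The scale n is the last whose denominator 2^(9^n) is affordable; the factor 2 makes n = 0
  -- admissible already for k = 0.
  obtain ⟨n, hn, hn1⟩ : ∃ n : ℕ, (2 : ℝ) ^ 9 ^ n ≤ 2 * (3 / 2) ^ k ∧
      2 * (3 / 2) ^ k < (2 : ℝ) ^ 9 ^ (n + 1) := by
    by_contra! hcon
    have hall : ∀ n : ℕ, (2 : ℝ) ^ 9 ^ n ≤ 2 * (3 / 2) ^ k := by
      intro n
      induction n with
      | zero =>
        have : (1 : ℝ) ≤ (3 / 2) ^ k := one_le_pow₀ (by norm_num)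
        norm_num
        linarith
      | succ n ih => exact hcon n ih
    obtain ⟨m, hm⟩ := pow_unbounded_of_one_lt (2 * (3 / 2 : ℝ) ^ k) (by norm_num : (1 : ℝ) < 2)
    have h1 : m ≤ 9 ^ m := (Nat.lt_pow_self (by norm_num)).le
    have h2 : (2 : ℝ) ^ m ≤ 2 ^ 9 ^ m := pow_le_pow_right₀ (by norm_num) h1
    linarith [hall m]
  -- Choose α or β by the parity of n, so that the digit at n + 1 is zero and the error is of order
  -- 2^(-9^(n+2)) before multiplication by the denominator.
  obtain ⟨a, b, hab, ha, hb, hdigit⟩ : ∃ a b : ℤ, (a ≠ 0 ∨ b ≠ 0) ∧ |(a : ℝ)| ≤ 1 ∧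
      |(b : ℝ)| ≤ 1 ∧ alternatingDigits a b (n + 1) = 0 := by
    by_cases hpar : Even n
    · exact ⟨1, 0, by simp, by simp, by simp, by simp [alternatingDigits, Nat.even_add_one, hpar]⟩
    · exact ⟨0, 1, by simp, by simp, by simp, by simp [alternatingDigits, Nat.even_add_one, hpar]⟩
  obtain ⟨p, hp⟩ := exists_int_abs_two_pow_mul_lacunarySum_add_le (M := 1)
    (fun m => (abs_alternatingDigits_le a b m).trans (max_le ha hb)) hdigit
  have hsplit : (3 / 4 : ℝ) ^ k = (1 / 2) ^ k * (3 / 2) ^ k := by rw [← mul_pow]; norm_num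
  have hcoord : ∀ z : ℤ, |(z : ℝ)| ≤ 1 →
      (1 / 2) ^ k * |((2 ^ 9 ^ n * z : ℤ) : ℝ)| ≤ 2 * (3 / 4) ^ k := by
    intro z hz
    push_cast
    rw [abs_mul, abs_of_pos (by positivity), hsplit]
    have : (2 : ℝ) ^ 9 ^ n * |(z : ℝ)| ≤ 2 * (3 / 2) ^ k :=
      (mul_le_of_le_one_right (by positivity) hz).trans hn
    calc _ ≤ (1 / 2 : ℝ) ^ k * (2 * (3 / 2) ^ k) :=
          mul_le_mul_of_nonneg_left this (by positivity)
      _ = _ := by ring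
  refine ⟨p, 2 ^ 9 ^ n * a, 2 ^ 9 ^ n * b, ?_, ?_, hcoord a ha, hcoord b hb⟩
  · simpa using hab
  · have hform : lacunarySum (alternatingDigits (2 ^ 9 ^ n * a) (2 ^ 9 ^ n * b))
        = 2 ^ 9 ^ n * lacunarySum (alternatingDigits a b) := by
      rw [lacunarySum_alternatingDigits, lacunarySum_alternatingDigits a b]
      push_cast
      ring
    rw [hform]
    set y : ℝ := 2 ^ 9 ^ (n + 1) with hy
    have hy0 : 0 < y := by positivity
    have hy1 : 1 ≤ y := one_le_pow₀ (by norm_num)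
    have h32 : (3 / 2 : ℝ) ^ k ≤ y := by
      have : (0 : ℝ) ≤ (3 / 2) ^ k := by positivity
      linarith
    have hxy : (2 : ℝ) ^ 9 ^ n ≤ y :=
      pow_le_pow_right₀ (by norm_num) (Nat.pow_le_pow_right (by norm_num) (Nat.le_succ n))
    have hyinv : (1 / 2 : ℝ) ^ 9 ^ (n + 2) = (y ^ 9)⁻¹ := by
      rw [hy, ← pow_mul, one_div, inv_pow, pow_succ 9 (n + 1)]
    -- This uses 10 ≤ (3/2)^7 · 3/4. Growth costs y^7 and the denominator at most y, against the
    -- gain y^(-9); this is why exponent ratio 9 suffices.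
    have h10 : (10 : ℝ) ^ k ≤ y ^ 7 * (3 / 4) ^ k := by
      calc (10 : ℝ) ^ k ≤ ((3 / 2) ^ 7 * (3 / 4)) ^ k :=
            pow_le_pow_left₀ (by norm_num) (by norm_num) k
        _ = ((3 / 2) ^ k) ^ 7 * (3 / 4) ^ k := by rw [mul_pow, ← pow_mul, ← pow_mul, mul_comm 7 k]
        _ ≤ y ^ 7 * (3 / 4) ^ k := by gcongr
    calc _ ≤ y ^ 7 * (3 / 4) ^ k * (y * (2 * 1 * (y ^ 9)⁻¹)) := by
          rw [hyinv] at hp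
          refine mul_le_mul h10 (hp.trans ?_) (abs_nonneg _) (by positivity)
          exact mul_le_mul_of_nonneg_right hxy (by positivity)
      _ = 2 * (3 / 4) ^ k * y⁻¹ := by field_simp
      _ ≤ 2 * (3 / 4) ^ k := mul_le_of_le_one_right (by positivity) (inv_le_one_of_one_le₀ hy1)

/-! ### The example dilation and its sections -/

theorem exampleDilation_det : exampleDilation.det = 5 / 2 := by
  simp [exampleDilation, Matrix.det_diagonal, Fin.prod_univ_three]
  norm_num

theorem exampleDilation_det_ne_zero : exampleDilation.det ≠ 0 := by
  rw [exampleDilation_det]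
  norm_num

theorem exampleDilation_pow (k : ℕ) :
    exampleDilation ^ (k : ℤ) = Matrix.diagonal ![10 ^ k, (1 / 2) ^ k, (1 / 2) ^ k] := by
  rw [zpow_natCast, exampleDilation, Matrix.diagonal_pow]
  congr 1
  ext i
  fin_cases i <;> simp

theorem matAct_exampleDilation_pow (k : ℕ) (x : EuclideanSpace ℝ (Fin 3)) :
    matAct (exampleDilation ^ (k : ℤ)) x =
      !₂[10 ^ k * x 0, (1 / 2) ^ k * x 1, (1 / 2) ^ k * x 2] := by
  rw [exampleDilation_pow]
  ext i
  fin_cases i <;> simp [matAct, Matrix.mulVec_diagonal]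

theorem norm_le_sum_abs (x : EuclideanSpace ℝ (Fin 3)) : ‖x‖ ≤ |x 0| + |x 1| + |x 2| := by
  rw [EuclideanSpace.norm_eq, Fin.sum_univ_three]
  simp only [Real.norm_eq_abs]
  refine Real.sqrt_le_iff.mpr ⟨by positivity, ?_⟩
  nlinarith [mul_nonneg (abs_nonneg (x 0)) (abs_nonneg (x 1)),
    mul_nonneg (abs_nonneg (x 0)) (abs_nonneg (x 2)),
    mul_nonneg (abs_nonneg (x 1)) (abs_nonneg (x 2))]

theorem mem_invDilatedBall {n : ℕ} {A : Matrix (Fin n) (Fin n) ℝ} (hA : A.det ≠ 0) {j : ℕ} {R : ℝ}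
    {x : EuclideanSpace ℝ (Fin n)} :
    x ∈ invDilatedBall A j R ↔ ‖matAct (A ^ (j : ℤ)) x‖ < R := by
  constructor
  · rintro ⟨y, hy, rfl⟩
    have := matAct_zpow_neg_zpow hA (-(j : ℤ)) y
    rw [neg_neg] at this
    rw [this]
    exact mem_ball_zero_iff.mp hy
  · intro h
    exact ⟨_, mem_ball_zero_iff.mpr h, matAct_zpow_neg_zpow hA j x⟩

theorem isOpen_invDilatedBall {n : ℕ} {A : Matrix (Fin n) (Fin n) ℝ} (hA : A.det ≠ 0) (j : ℕ)
    (R : ℝ) : IsOpen (invDilatedBall A j R) := by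
  have : invDilatedBall A j R = {x | ‖matAct (A ^ (j : ℤ)) x‖ < R} := by
    ext x
    exact mem_invDilatedBall hA
  rw [this]
  have hc : Continuous (matAct (A ^ (j : ℤ))) :=
    LinearMap.continuous_of_finiteDimensional (Matrix.toEuclideanLin (A ^ (j : ℤ)))
  exact isOpen_lt hc.norm continuous_const

theorem abs_fst_lt_of_mem_invDilatedBall {j : ℕ} {R : ℝ} {x : EuclideanSpace ℝ (Fin 3)}
    (h : x ∈ invDilatedBall exampleDilation j R) : |x 0| < R / 10 ^ j := by
  rw [mem_invDilatedBall exampleDilation_det_ne_zero, matAct_exampleDilation_pow] at h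
  have h0 := (PiLp.norm_apply_le _ 0).trans_lt h
  simp only [Real.norm_eq_abs, Matrix.cons_val_zero, abs_mul] at h0
  rw [abs_of_pos (by positivity)] at h0
  rw [lt_div_iff₀ (by positivity)]
  linarith

theorem norm_lt_of_mem_invDilatedBall {j : ℕ} {R : ℝ} {x : EuclideanSpace ℝ (Fin 3)}
    (h : x ∈ invDilatedBall exampleDilation j R) : ‖x‖ < 2 ^ j * (3 * R) := by
  rw [mem_invDilatedBall exampleDilation_det_ne_zero, matAct_exampleDilation_pow] at h
  have h0 := (PiLp.norm_apply_le _ 0).trans_lt h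
  have h1 := (PiLp.norm_apply_le _ 1).trans_lt h
  have h2 := (PiLp.norm_apply_le _ 2).trans_lt h
  simp only [Real.norm_eq_abs, Matrix.cons_val_zero, Matrix.cons_val_one,
    Matrix.cons_val_two, Matrix.tail_cons, Matrix.head_cons, abs_mul, abs_pow,
    one_div, abs_inv, Nat.abs_ofNat, inv_pow] at h0 h1 h2
  have h2j : (1 : ℝ) ≤ 2 ^ j := one_le_pow₀ (by norm_num)
  have h10j : (1 : ℝ) ≤ 10 ^ j := one_le_pow₀ (by norm_num)
  rw [inv_mul_lt_iff₀ (by positivity)] at h1 h2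
  have h0' : |x 0| < 2 ^ j * R := by
    have hR : 0 < R := (norm_nonneg _).trans_lt h
    calc |x 0| ≤ 10 ^ j * |x 0| := le_mul_of_one_le_left (abs_nonneg _) h10j
      _ < R := h0
      _ ≤ 2 ^ j * R := le_mul_of_one_le_left hR.le h2j
  linarith [norm_le_sum_abs x]

/-- Sections of the sets `A^{-j} B(0, R)` by a subspace that is not contained in the plane
`x₀ = 0` have measures tending to zero. -/
theorem tendsto_sectionMeasure_exampleDilation {V : Submodule ℝ (EuclideanSpace ℝ (Fin 3))}
    {u : EuclideanSpace ℝ (Fin 3)} (huV : u ∈ V) (hu : u 0 ≠ 0) {R : ℝ} (hR : 0 < R) :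
    Tendsto (fun j : ℕ => sectionMeasure V (invDilatedBall exampleDilation j R)) atTop (𝓝 0) := by
  set μ := (stdOrthonormalBasis ℝ V).toBasis.addHaar with hμ
  have : Nontrivial V := ⟨⟨u, huV⟩, 0, fun h => hu (by
    have : u = 0 := congrArg Subtype.val h
    simp [this])⟩
  -- First coordinate 2R: shifting by w / 10^j moves by exactly the width of the slab |x₀| < R /
  -- 10^j, so the shifts are disjoint.
  set w : V := (2 * R / u 0) • ⟨u, huV⟩ with hw
  have hw0 : (w : EuclideanSpace ℝ (Fin 3)) 0 = 2 * R := by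
    simp [hw, hu]
  set C := 3 * R + ‖w‖ with hCdef
  have hC : 0 < C := by positivity
  set b := μ (Metric.ball (0 : V) C) with hb
  have hbfin : b ≠ ∞ := measure_ball_lt_top.ne
  set d := Module.finrank ℝ V with hd
  have hd3 : d ≤ 3 := by
    simpa using V.finrank_le
  have hbound : ∀ j : ℕ, sectionMeasure V (invDilatedBall exampleDilation j R)
      ≤ ENNReal.ofReal ((2 / 5) ^ j) * b := by
    intro j
    set S : Set V := {v : V | (v : EuclideanSpace ℝ (Fin 3)) ∈ invDilatedBall exampleDilation j R}
    have hSm : MeasurableSet S :=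
      ((isOpen_invDilatedBall exampleDilation_det_ne_zero j R).preimage
        continuous_subtype_val).measurableSet
    -- For m < 20^j the shift (m / 10^j) w has length at most 2^j ‖w‖, comparable to the section's
    -- own size. Thus 20^j copies fit in a ball of measure at most 8^j b, as dim V ≤ 3.
    have hpack : ((20 ^ j : ℕ) : ℝ≥0∞) * μ S ≤ μ (Metric.ball (0 : V) (2 ^ j * C)) := by
      refine card_mul_measure_le_of_packing μ hSm.nullMeasurableSet
        (fun m => ((m : ℝ) / 10 ^ j) • w) (20 ^ j) (Eventually.of_forall fun x => ?_)
      by_cases hx : x ∈ Metric.ball (0 : V) (2 ^ j * C)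
      · rw [Set.indicator_of_mem hx]
        refine sum_indicator_one_le_one_of_subsingleton _ _ fun m _ m' _ hm hm' => ?_
        have h1 := abs_fst_lt_of_mem_invDilatedBall hm
        have h2 := abs_fst_lt_of_mem_invDilatedBall hm'
        simp only [Submodule.coe_add, Submodule.coe_smul, PiLp.add_apply, PiLp.smul_apply,
          smul_eq_mul, hw0] at h1 h2
        have h3 : |((m : ℝ) - m') * (2 * R)| < 2 * R := by
          have h10 : (0 : ℝ) < 10 ^ j := by positivity
          have e : ((m : ℝ) - m') * (2 * R) =
            10 ^ j * (((x : EuclideanSpace ℝ (Fin 3)) 0 + m / 10 ^ j * (2 * R))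
              - ((x : EuclideanSpace ℝ (Fin 3)) 0 + m' / 10 ^ j * (2 * R))) := by
            field_simp
            ring
          rw [e, abs_mul, abs_of_pos h10]
          refine (mul_lt_mul_of_pos_left ((abs_sub _ _).trans_lt (add_lt_add h1 h2)) h10).trans_eq ?_
          field_simp
          ring
        rw [abs_mul, abs_of_pos (by positivity : 0 < 2 * R)] at h3
        have h4 : |((m : ℤ) - (m' : ℤ))| < 1 := by
          have : |(m : ℝ) - m'| < 1 := by
            by_contra! hcon
            nlinarith
          exact_mod_cast this
        have := Int.abs_lt_one_iff.mp h4
        omega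
      · rw [Finset.sum_eq_zero]
        · exact zero_le
        · intro m hm
          refine Set.indicator_of_notMem (fun hmem => hx ?_) _
          have h1 : ‖x + ((m : ℝ) / 10 ^ j) • w‖ < 2 ^ j * (3 * R) :=
            norm_lt_of_mem_invDilatedBall hmem
          have h2 : ‖((m : ℝ) / 10 ^ j) • w‖ ≤ 2 ^ j * ‖w‖ := by
            rw [norm_smul]
            refine mul_le_mul_of_nonneg_right ?_ (norm_nonneg _)
            rw [Real.norm_of_nonneg (by positivity), div_le_iff₀ (by positivity), ← mul_pow]
            have : (m : ℝ) ≤ ((20 ^ j : ℕ) : ℝ) :=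
              Nat.cast_le.mpr (Finset.mem_range.mp hm).le
            push_cast at this
            norm_num
            exact this
          rw [mem_ball_zero_iff]
          calc ‖x‖ = ‖(x + ((m : ℝ) / 10 ^ j) • w) - ((m : ℝ) / 10 ^ j) • w‖ := by
                rw [add_sub_cancel_right]
            _ ≤ _ := norm_sub_le _ _
            _ < 2 ^ j * C := by rw [hCdef]; linarith
    rw [Measure.addHaar_ball_mul _ _ (by positivity)] at hpack
    have h8 : ENNReal.ofReal (((2 : ℝ) ^ j) ^ d) ≤ ENNReal.ofReal (8 ^ j) := by
      refine ENNReal.ofReal_le_ofReal ?_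
      calc ((2 : ℝ) ^ j) ^ d ≤ (2 ^ j) ^ 3 := pow_le_pow_right₀ (one_le_pow₀ (by norm_num)) hd3
        _ = 8 ^ j := by rw [← pow_mul, mul_comm, pow_mul]; norm_num
    have h20 : ((20 ^ j : ℕ) : ℝ≥0∞) ≠ 0 := by positivity
    have hS : μ S ≤ ENNReal.ofReal (8 ^ j) * b / ((20 ^ j : ℕ) : ℝ≥0∞) := by
      rw [ENNReal.le_div_iff_mul_le (Or.inl h20) (Or.inl (ENNReal.natCast_ne_top _)), mul_comm]
      exact hpack.trans (mul_le_mul_left h8 _)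
    refine hS.trans_eq ?_
    rw [mul_comm, mul_div_assoc, mul_comm, ← ENNReal.ofReal_natCast,
      ← ENNReal.ofReal_div_of_pos (by positivity)]
    congr 2
    push_cast
    rw [← div_pow]
    norm_num
  refine tendsto_of_tendsto_of_tendsto_of_le_of_le tendsto_const_nhds ?_ (fun _ => zero_le) hbound
  have h1 : Tendsto (fun j : ℕ => ENNReal.ofReal ((2 / 5 : ℝ) ^ j)) atTop (𝓝 0) := by
    simpa using ENNReal.tendsto_ofReal
      (tendsto_pow_atTop_nhds_zero_of_lt_one (by norm_num : (0 : ℝ) ≤ 2 / 5) (by norm_num))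
  simpa using ENNReal.Tendsto.mul_const h1 (Or.inr hbfin)

theorem sectionMeasure_bot_le_one {n : ℕ} (S : Set (EuclideanSpace ℝ (Fin n))) :
    sectionMeasure ⊥ S ≤ 1 := by
  have h : (stdOrthonormalBasis ℝ (⊥ : Submodule ℝ (EuclideanSpace ℝ (Fin n)))).toBasis.addHaar
      (parallelepiped (stdOrthonormalBasis ℝ
        (⊥ : Submodule ℝ (EuclideanSpace ℝ (Fin n)))).toBasis) = 1 :=
    Module.Basis.addHaar_self _
  rw [← h]
  refine measure_mono fun v _ => ?_
  rw [Subsingleton.elim v 0, mem_parallelepiped_iff]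
  exact ⟨0, by simp, by simp⟩

/-! ### The lattice -/

/-- The shear `(x, y, z) ↦ (x + α y + β z, y, z)`. -/
noncomputable def shear (α β : ℝ) : EuclideanSpace ℝ (Fin 3) ≃ₗ[ℝ] EuclideanSpace ℝ (Fin 3) where
  toFun x := !₂[x 0 + α * x 1 + β * x 2, x 1, x 2]
  invFun x := !₂[x 0 - α * x 1 - β * x 2, x 1, x 2]
  map_add' x y := by ext i; fin_cases i <;> simp; ring
  map_smul' c x := by ext i; fin_cases i <;> simp; ring
  left_inv x := by ext i; fin_cases i <;> simp; ring
  right_inv x := by ext i; fin_cases i <;> simp; ring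

/-- The basis obtained by shearing the standard basis. -/
noncomputable def shearBasis (α β : ℝ) : Module.Basis (Fin 3) ℝ (EuclideanSpace ℝ (Fin 3)) :=
  (EuclideanSpace.basisFun (Fin 3) ℝ).toBasis.map (shear α β)

/-- The lattice of all vectors `(p + α q + β r, q, r)` with integers `p`, `q`, `r`. -/
noncomputable def shearLattice (α β : ℝ) : Submodule ℤ (EuclideanSpace ℝ (Fin 3)) :=
  Submodule.span ℤ (Set.range (shearBasis α β))

theorem mem_shearLattice {α β : ℝ} {x : EuclideanSpace ℝ (Fin 3)} :
    x ∈ shearLattice α β ↔ ∃ p q r : ℤ, x = !₂[p + α * q + β * r, (q : ℝ), (r : ℝ)] := by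
  have hsum : ∀ c : Fin 3 → ℤ, ∑ i, c i • shearBasis α β i
      = !₂[c 0 + α * c 1 + β * c 2, (c 1 : ℝ), (c 2 : ℝ)] := by
    intro c
    ext i
    fin_cases i <;> simp [shearBasis, shear, Fin.sum_univ_three]; ring
  rw [shearLattice, Submodule.mem_span_range_iff_exists_fun]
  constructor
  · rintro ⟨c, rfl⟩
    exact ⟨c 0, c 1, c 2, hsum c⟩
  · rintro ⟨p, q, r, rfl⟩
    exact ⟨![p, q, r], by rw [hsum]; simp⟩

/-- The sheared lattice whose parameters are the alternating lacunary sums. -/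
noncomputable def exampleLattice : Submodule ℤ (EuclideanSpace ℝ (Fin 3)) :=
  shearLattice (lacunarySum (alternatingDigits 1 0)) (lacunarySum (alternatingDigits 0 1))

theorem mem_exampleLattice {x : EuclideanSpace ℝ (Fin 3)} :
    x ∈ exampleLattice ↔
      ∃ p q r : ℤ, x = !₂[p + lacunarySum (alternatingDigits q r), (q : ℝ), (r : ℝ)] := by
  rw [exampleLattice, mem_shearLattice]
  refine exists_congr fun p => exists_congr fun q => exists_congr fun r => ?_
  rw [lacunarySum_alternatingDigits q r, mul_comm (q : ℝ), mul_comm (r : ℝ), add_assoc]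

instance : DiscreteTopology exampleLattice :=
  inferInstanceAs (DiscreteTopology (Submodule.span ℤ (Set.range (shearBasis _ _))))

instance : IsZLattice ℝ exampleLattice :=
  inferInstanceAs (IsZLattice ℝ (Submodule.span ℤ (Set.range (shearBasis _ _))))

theorem eq_zero_of_mem_exampleLattice {x : EuclideanSpace ℝ (Fin 3)} (hx : x ∈ exampleLattice)
    (h0 : x 0 = 0) : x = 0 := by
  obtain ⟨p, q, r, rfl⟩ := mem_exampleLattice.mp hx
  obtain ⟨rfl, rfl, rfl⟩ := eq_zero_of_add_lacunarySum_alternatingDigits_eq_zero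
    (p := p) (q := q) (r := r) (by simpa using h0)
  ext i
  fin_cases i
  · exact h0
  · simp
  · simp

theorem exists_mem_exampleLattice_norm_le (k : ℕ) : ∃ u ∈ exampleLattice, u ≠ 0 ∧
    ‖matAct (exampleDilation ^ (k : ℤ)) u‖ ≤ 6 * (3 / 4) ^ k := by
  obtain ⟨p, q, r, hqr, hx, hq, hr⟩ := exists_int_small_linear_form k
  refine ⟨_, mem_exampleLattice.mpr ⟨p, q, r, rfl⟩, fun h => ?_, ?_⟩
  · have h1 := congrArg (fun v : EuclideanSpace ℝ (Fin 3) => v 1) h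
    have h2 := congrArg (fun v : EuclideanSpace ℝ (Fin 3) => v 2) h
    simp at h1 h2
    exact hqr.elim (fun hq0 => hq0 h1) (fun hr0 => hr0 h2)
  · rw [matAct_exampleDilation_pow]
    refine (norm_le_sum_abs _).trans ?_
    have e10 : |(10 : ℝ) ^ k| = 10 ^ k := abs_of_pos (by positivity)
    have e2 : |(1 / 2 : ℝ) ^ k| = (1 / 2) ^ k := abs_of_pos (by positivity)
    simp only [Matrix.cons_val_zero, Matrix.cons_val_one, Matrix.cons_val,
      abs_mul, e10, e2]
    linarith

theorem mainTheorem7 :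
    1 < |exampleDilation.det| ∧
    ∃ (Γ : Submodule ℤ (EuclideanSpace ℝ (Fin 3))) (_ : DiscreteTopology Γ),
      IsZLattice ℝ Γ ∧
      (¬ ∃ W : Set (EuclideanSpace ℝ (Fin 3)), IsWaveletSet exampleDilation Γ W) ∧
      (∀ R : ℝ, 0 < R → ∀ F : Set (EuclideanSpace ℝ (Fin 3)), F ⊆ (Γ : Set _) →
        Submodule.span ℝ F ≠ ⊥ →
        Tendsto (fun j : ℕ =>
          sectionMeasure (Submodule.span ℝ F) (invDilatedBall exampleDilation j R))
          atTop (𝓝 0)) ∧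
      (¬ ∃ R : ℝ, 0 < R ∧ ∃ F : Set (EuclideanSpace ℝ (Fin 3)), F ⊆ (Γ : Set _) ∧
        Tendsto (fun j : ℕ =>
          sectionMeasure (Submodule.span ℝ F) (invDilatedBall exampleDilation j R))
          atTop (𝓝 ⊤)) := by
  have hdet : 1 < |exampleDilation.det| := by
    rw [exampleDilation_det]
    norm_num
  have hsec : ∀ R : ℝ, 0 < R → ∀ F : Set (EuclideanSpace ℝ (Fin 3)),
      F ⊆ (exampleLattice : Set _) → Submodule.span ℝ F ≠ ⊥ →
      Tendsto (fun j : ℕ =>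
        sectionMeasure (Submodule.span ℝ F) (invDilatedBall exampleDilation j R))
        atTop (𝓝 0) := by
    intro R hR F hF hspan
    obtain ⟨u, huF, hu⟩ : ∃ u ∈ F, u ≠ 0 := by
      by_contra! hcon
      exact hspan (Submodule.span_eq_bot.mpr hcon)
    exact tendsto_sectionMeasure_exampleDilation (Submodule.subset_span huF)
      (fun h0 => hu (eq_zero_of_mem_exampleLattice (hF huF) h0)) hR
  refine ⟨hdet, exampleLattice, inferInstance, inferInstance,
    not_exists_isWaveletSet hdet (by norm_num) (by norm_num) (by norm_num)
      exists_mem_exampleLattice_norm_le, hsec, ?_⟩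
  -- The span {0} is not covered by the zero limit; there the point mass keeps the measures at most
  -- 1.
  rintro ⟨R, hR, F, hF, hlim⟩
  by_cases hspan : Submodule.span ℝ F = ⊥
  · rw [hspan] at hlim
    exact absurd (le_of_tendsto' hlim fun j => sectionMeasure_bot_le_one _) (by simp)
  · exact ENNReal.zero_ne_top (tendsto_nhds_unique (hsec R hR F hF hspan) hlim)
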